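/- For real $t>0$ let $\zeta(s,t)$ denote the Hurwitz zeta function, i.e. the meromorphic continuation in $s$ to $\mathbb{C}\setminus\{1\}$ of $\sum_{k\ge 0}(k+t)^{-s}$ $(\operatorname{Re} s>1)$; put $\zeta(s,0)=\zeta(s)$ (the Riemann zeta function), and let $\zeta'(s,t)=\frac{\partial}{\partial s}\zeta(s,t)$. Let $B_m(x)$ be the Bernoulli polynomials and $B_m=B_m(0)$ the Bernoulli numbers. Then for every integer $n\ge 1$ and every real $\nu\ge 0$ the function $t\mapsto\zeta'(1-n,t)$ is integrable on $[0,\nu]$ and $$n\int_0^\nu \zeta'(1-n,t)\,dt=\frac{B_{n+1}-B_{n+1}(\nu)}{n(n+1)}+\zeta'(-n,\nu)-\zeta'(-n,0).$$ In particular, for $n=2$ and every real $\nu\ge 0$, $$\int_0^\nu \zeta'(-1,t)\,dt=-\frac{1}{12}B_3(\nu)+\frac12\,\zeta'(-2,\nu)+\frac{\zeta(3)}{8\pi^2}.$$ -/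

import Mathlib

open scoped Real

/-- The Hurwitz zeta function `ζ(s, t)` for real `t ≥ 0`, that is, the continuation in `s` of
`∑ k ≥ 0, (k + t) ^ (-s)` (for `t = 0` the undefined term `k = 0` is left out, so `ζ(s, 0) = ζ(s)`).
Mathlib's `HurwitzZeta.hurwitzZeta` is periodic in the second argument and agrees with `ζ(s, t)` for
`t ∈ [0, 1]`; for larger `t` the finitely many surplus initial terms are subtracted.
See `hasSum_zetaH` and `differentiableAt_zetaH`. -/
noncomputable def zetaH (s : ℂ) (t : ℝ) : ℂ :=
  HurwitzZeta.hurwitzZeta (t : UnitAddCircle) s -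
    ∑ k ∈ Finset.range (⌈t⌉₊ - 1), 1 / ((k : ℂ) + ((t - (⌈t⌉₊ - 1 : ℕ) : ℝ) : ℂ)) ^ s

/-- The derivative `ζ'(s, t) = ∂ζ(s, t)/∂s` of the Hurwitz zeta function. -/
noncomputable def zetaHDeriv (s : ℂ) (t : ℝ) : ℂ :=
  deriv (fun z : ℂ => zetaH z t) s

/-- `ζ(s, t)` is given by the Hurwitz series in the half-plane of convergence. -/
theorem hasSum_zetaH {t : ℝ} (ht : 0 ≤ t) {s : ℂ} (hs : 1 < s.re) :
    HasSum (fun k : ℕ => 1 / ((k : ℂ) + (t : ℂ)) ^ s) (zetaH s t) := by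
  have hmem : t - (⌈t⌉₊ - 1 : ℕ) ∈ Set.Icc (0 : ℝ) 1 := by
    have h1 := Nat.le_ceil t
    have h2 := Nat.ceil_lt_add_one ht
    rcases Nat.eq_zero_or_pos ⌈t⌉₊ with h | h
    · rw [h] at h1 ⊢
      simp only [Nat.cast_zero] at h1
      constructor <;> simp <;> linarith
    · rw [Nat.cast_sub h]
      constructor <;> push_cast <;> linarith
  have hcirc : ((t - (⌈t⌉₊ - 1 : ℕ) : ℝ) : UnitAddCircle) = (t : UnitAddCircle) := by
    rw [AddCircle.coe_sub, sub_eq_self]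
    exact (AddCircle.coe_eq_zero_iff 1).2 ⟨(⌈t⌉₊ - 1 : ℕ), by simp⟩
  have h := HurwitzZeta.hasSum_hurwitzZeta_of_one_lt_re hmem hs
  rw [hcirc] at h
  have h' := (hasSum_nat_add_iff' (⌈t⌉₊ - 1)).2 h
  refine h'.congr_fun ?_
  intro k
  congr 2
  push_cast
  ring

/-- `ζ(s, t)` is holomorphic in `s` away from `s = 1`. -/
theorem differentiableAt_zetaH {t : ℝ} (ht : 0 ≤ t) {s : ℂ} (hs : s ≠ 1) :
    DifferentiableAt ℂ (fun z : ℂ => zetaH z t) s := by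
  refine (HurwitzZeta.differentiableAt_hurwitzZeta _ hs).sub (DifferentiableAt.fun_sum ?_)
  intro k hk
  have hk' : 0 < (k : ℝ) + (t - (⌈t⌉₊ - 1 : ℕ)) := by
    have h1 := Nat.ceil_lt_add_one ht
    have h2 : 1 ≤ ⌈t⌉₊ := by
      have := Finset.mem_range.1 hk
      omega
    have h3 : t - (⌈t⌉₊ - 1 : ℕ) > 0 := by
      rw [Nat.cast_sub h2]
      push_cast
      linarith
    positivity
  have hne : (k : ℂ) + ((t - (⌈t⌉₊ - 1 : ℕ) : ℝ) : ℂ) ≠ 0 := by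
    exact_mod_cast hk'.ne'
  refine (differentiableAt_const _).div (differentiableAt_id.const_cpow (Or.inl hne)) ?_
  exact fun h => hne ((Complex.cpow_eq_zero_iff _ _).1 h).1

/-- The value at `t = 0` is the Riemann zeta function. -/
theorem zetaH_zero (s : ℂ) : zetaH s 0 = riemannZeta s := by
  simp [zetaH, HurwitzZeta.hurwitzZeta_zero]

section HurwitzIntegral

open Set Filter Topology MeasureTheory Complex

/-! ### Parametric interval integrals of holomorphic functions -/

/-! Termwise integration of the series gives `(1 - s) ∫₁ˣ ζ(s,t) dt = ζ(s-1,x) - ζ(s-1)` for `Re s >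
2` (`one_sub_mul_integral_zetaH`). Subtracting `ζ(s)` removes the pole, and the identity theorem
carries the relation to all `s` (`zetaHSub_sub_one`). Its `s`-derivative at `s = 1 - n` evaluates
`∫₁ˣ ζ'(1-n,t) dt`, with Bernoulli terms coming from `ζ(-n,x)`.

Working on `t ≥ 1` avoids the singularity at `t = 0`. The shift `ζ(s,t) = t^(-s) + ζ(s,t+1)` then
turns the integral over `[0,ν]` into one over `[1,ν+1]` minus the elementary integral of `t^(n-1)
log t`. For `n = 2` the constant is `ζ'(-2)`, found from the functional equation. -/

theorem hasDerivAt_intervalIntegral_of_continuousOn_prod {f : ℂ → ℝ → ℂ} {U : Set ℂ}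
    (hU : IsOpen U) (hf : ContinuousOn (fun p : ℂ × ℝ => f p.1 p.2) (U ×ˢ univ))
    (hd : ∀ t, DifferentiableOn ℂ (fun s => f s t) U) {s : ℂ} (hs : s ∈ U) (a b : ℝ) :
    IntervalIntegrable (fun t => deriv (fun z => f z t) s) volume a b ∧
      HasDerivAt (fun z => ∫ t in a..b, f z t)
        (∫ t in a..b, deriv (fun z => f z t) s) s := by
  obtain ⟨R, hR, hball⟩ := Metric.nhds_basis_closedBall.mem_iff.1 (hU.mem_nhds hs)
  have hcont : ∀ z ∈ U, Continuous (f z) := fun z hz =>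
    hf.comp_continuous (f := fun t : ℝ => (z, t)) (by fun_prop) fun t => ⟨hz, mem_univ _⟩
  have hK : IsCompact (Metric.closedBall s R ×ˢ uIcc a b) :=
    (isCompact_closedBall s R).prod isCompact_uIcc
  obtain ⟨C, hC⟩ := hK.exists_bound_of_continuousOn
    (hf.mono (prod_mono hball (subset_univ _)))
  have hr : 0 < R / 2 := by positivity
  refine intervalIntegral.hasDerivAt_integral_of_dominated_loc_of_deriv_le
    (F' := fun z t => deriv (fun w => f w t) z) (bound := fun _ => C / (R / 2))
    (Metric.ball_mem_nhds s hr) ?_ ((hcont s hs).intervalIntegrable _ _) ?_ ?_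
    intervalIntegrable_const ?_
  · filter_upwards [hU.mem_nhds hs] with z hz
    exact (hcont z hz).aestronglyMeasurable
  -- The derivative is measurable in `t` as a limit of continuous difference quotients; the
  -- increments `R / (n + 1)` stay within the closed ball.
  · have hlim : Tendsto (fun n : ℕ => ((R / (n + 1) : ℝ) : ℂ)) atTop (𝓝[≠] 0) := by
      refine tendsto_nhdsWithin_iff.2 ⟨?_, Eventually.of_forall fun n => ?_⟩
      · have h := (tendsto_const_div_atTop_nhds_zero_nat R).comp (tendsto_add_atTop_nat 1)
        have h2 := (continuous_ofReal.tendsto 0).comp h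
        simpa [Function.comp_def] using h2
      · simp only [mem_compl_iff, mem_singleton_iff, ofReal_eq_zero]
        positivity
    refine aestronglyMeasurable_of_tendsto_ae atTop
      (f := fun (n : ℕ) t => ((R / (n + 1) : ℝ) : ℂ)⁻¹ • (f (s + (R / (n + 1) : ℝ)) t - f s t))
      (fun n => ?_) (Eventually.of_forall fun t => ?_)
    · have hmem : s + ((R / (n + 1) : ℝ) : ℂ) ∈ U := by
        apply hball
        rw [Metric.mem_closedBall, dist_eq_norm, add_sub_cancel_left, norm_real,
          Real.norm_of_nonneg (by positivity)]
        exact div_le_self hR.le (by simp)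
      have h1 := hcont _ hmem
      have h2 := hcont _ hs
      exact Continuous.aestronglyMeasurable (by fun_prop)
    · have h := ((hd t).differentiableAt (hU.mem_nhds hs)).hasDerivAt
      exact (hasDerivAt_iff_tendsto_slope_zero.1 h).comp hlim
  · refine Eventually.of_forall fun t ht z hz => ?_
    have hsub : Metric.closedBall z (R / 2) ⊆ Metric.closedBall s R := by
      refine Metric.closedBall_subset_closedBall' ?_
      have := Metric.mem_ball.1 hz
      linarith
    -- Cauchy's estimate on the circle of radius `R / 2` about `z`, where `f` is bounded by `C`.
    refine norm_deriv_le_of_forall_mem_sphere_norm_le hr ?_ fun w hw =>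
      hC (w, t) ⟨hsub (Metric.sphere_subset_closedBall hw), uIoc_subset_uIcc ht⟩
    exact ((hd t).mono (hsub.trans hball)).diffContOnCl_ball Subset.rfl
  · refine Eventually.of_forall fun t _ z hz => ?_
    refine ((hd t).differentiableAt (hU.mem_nhds (hball ?_))).hasDerivAt
    have := Metric.mem_ball.1 hz
    exact Metric.mem_closedBall.2 (by linarith)

/-! ### Elementary properties of `zetaH` -/

theorem zetaH_eq_cpow_add {t : ℝ} (ht : 0 < t) (s : ℂ) :
    zetaH s t = 1 / (t : ℂ) ^ s + zetaH s (t + 1) := by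
  have hc : ⌈t + 1⌉₊ = ⌈t⌉₊ + 1 := Nat.ceil_add_one ht.le
  have hp : 1 ≤ ⌈t⌉₊ := Nat.one_le_iff_ne_zero.2 (Nat.ceil_pos.2 ht).ne'
  obtain ⟨m, hm⟩ := Nat.exists_eq_add_of_le' hp
  have hcirc : ((t + 1 : ℝ) : UnitAddCircle) = (t : UnitAddCircle) := by
    rw [AddCircle.coe_add, AddCircle.coe_period, add_zero]
  rw [zetaH, zetaH, hc, hcirc, hm]
  simp only [Nat.add_sub_cancel, Finset.sum_range_succ]
  have h1 : t + 1 - ((m + 1 : ℕ) : ℝ) = t - (m : ℕ) := by push_cast; ring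
  rw [h1]
  have h2 : (m : ℂ) + ((t - (m : ℕ) : ℝ) : ℂ) = t := by push_cast; ring
  rw [h2]
  ring

theorem zetaH_one (s : ℂ) : zetaH s 1 = riemannZeta s := by
  have : ((1 : ℝ) : UnitAddCircle) = 0 := AddCircle.coe_period 1
  simp [zetaH, this, HurwitzZeta.hurwitzZeta_zero]

theorem differentiable_zetaH_sub_riemannZeta {t : ℝ} (ht : 0 < t) :
    Differentiable ℂ fun s => zetaH s t - riemannZeta s := by
  have h := (HurwitzZeta.differentiable_hurwitzZeta_sub_hurwitzZeta (t : UnitAddCircle) 0)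
  have hp : 1 ≤ ⌈t⌉₊ := Nat.one_le_iff_ne_zero.2 (Nat.ceil_pos.2 ht).ne'
  simp only [zetaH, HurwitzZeta.hurwitzZeta_zero, sub_right_comm _ _ (riemannZeta _)] at h ⊢
  refine h.sub (Differentiable.fun_sum fun k _ => ?_)
  have hk' : 0 < (k : ℝ) + (t - (⌈t⌉₊ - 1 : ℕ)) := by
    have h1 := Nat.ceil_lt_add_one ht.le
    rw [Nat.cast_sub hp]
    push_cast
    have : (0 : ℝ) ≤ k := k.cast_nonneg
    linarith
  have hne : (k : ℂ) + ((t - (⌈t⌉₊ - 1 : ℕ) : ℝ) : ℂ) ≠ 0 := by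
    exact_mod_cast hk'.ne'
  intro s
  refine (differentiableAt_const _).div (differentiableAt_id.const_cpow (Or.inl hne)) ?_
  exact fun h => hne ((cpow_eq_zero_iff _ _).1 h).1

theorem bernoulliFun_add_one (k : ℕ) (x : ℝ) :
    bernoulliFun k (x + 1) = bernoulliFun k x + k * x ^ (k - 1) := by
  have h := congrArg (fun p => (Polynomial.map (algebraMap ℚ ℝ) p).eval x)
    (Polynomial.bernoulli_comp_one_add_X k)
  simpa [bernoulliFun, Polynomial.map_comp, add_comm] using h

theorem zetaH_neg_nat_of_le_one {n : ℕ} (hn : n ≠ 0) {t : ℝ} (ht : 0 ≤ t) (h1 : t ≤ 1) :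
    zetaH (-n) t = -(bernoulliFun (n + 1) t : ℂ) / (n + 1) := by
  have h := HurwitzZeta.hurwitzZeta_neg_nat (x := t) hn ⟨ht, h1⟩
  have hb : (((Polynomial.bernoulli (n + 1)).map (algebraMap ℚ ℂ)).eval (t : ℂ))
      = (bernoulliFun (n + 1) t : ℂ) := by
    rw [bernoulliFun, Polynomial.eval_map_algebraMap, Polynomial.eval_map_algebraMap]
    exact Polynomial.aeval_algebraMap_apply ℂ t _
  have hc : ⌈t⌉₊ - 1 = 0 := by
    have : ⌈t⌉₊ ≤ 1 := Nat.ceil_le.2 (by simpa using h1)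
    omega
  rw [zetaH, hc, h, hb]
  simp
  ring

/-- Both sides satisfy the same difference equation in `t`, so the formula on `[0,1]` propagates by
unit steps. -/
theorem zetaH_neg_nat {n : ℕ} (hn : n ≠ 0) {t : ℝ} (ht : 0 ≤ t) :
    zetaH (-n) t = -(bernoulliFun (n + 1) t : ℂ) / (n + 1) := by
  obtain ⟨m, hm⟩ := exists_nat_ge t
  induction m generalizing t with
  | zero =>
    rw [Nat.cast_zero] at hm
    exact zetaH_neg_nat_of_le_one hn ht (hm.trans zero_le_one)
  | succ m ih =>
    rcases le_or_gt t 1 with h1 | h1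
    · exact zetaH_neg_nat_of_le_one hn ht h1
    · have h := zetaH_eq_cpow_add (sub_pos.2 h1) (-n : ℂ)
      rw [sub_add_cancel, ih (by linarith) (by push_cast at hm; linarith)] at h
      have hb := bernoulliFun_add_one (n + 1) (t - 1)
      rw [sub_add_cancel] at hb
      rw [← sub_eq_iff_eq_add'] at h
      have hn1 : (n : ℂ) + 1 ≠ 0 := by exact_mod_cast n.succ_ne_zero
      rw [← h, hb, cpow_neg, cpow_natCast, Nat.add_sub_cancel]
      push_cast
      field_simp
      ring

/-! ### The value `ζ'(-2)` -/

/-- In the functional equation for `ζ(1 - s)` the factor `cos(πs/2)` vanishes at `s = 3`, so only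
its derivative contributes there. -/
theorem deriv_riemannZeta_neg_two :
    deriv riemannZeta (-2) = -(riemannZeta 3 / (4 * (π : ℂ) ^ 2)) := by
  have hπ : (π : ℂ) ≠ 0 := ofReal_ne_zero.2 Real.pi_ne_zero
  have h3 : ∀ᶠ s : ℂ in 𝓝 3, riemannZeta (1 - s) =
      cos (π * s / 2) * (2 * (2 * π) ^ (-s) * Gamma s * riemannZeta s) := by
    have : {s : ℂ | 1 < s.re} ∈ 𝓝 (3 : ℂ) :=
      (isOpen_lt continuous_const continuous_re).mem_nhds (by simp)
    filter_upwards [this] with s hs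
    rw [riemannZeta_one_sub]
    · ring
    · rintro n rfl
      simp only [neg_re, natCast_re] at hs
      have : (0 : ℝ) ≤ n := n.cast_nonneg
      linarith
    · rintro rfl
      simp at hs
  have hcos0 : cos (π * 3 / 2 : ℂ) = 0 := by
    rw [show (π * 3 / 2 : ℂ) = π / 2 + π by ring, cos_add_pi, cos_pi_div_two, neg_zero]
  have hsin0 : sin (π * 3 / 2 : ℂ) = -1 := by
    rw [show (π * 3 / 2 : ℂ) = π / 2 + π by ring, sin_add_pi, sin_pi_div_two]
  have hcos : HasDerivAt (fun s : ℂ => cos (π * s / 2)) (π / 2 : ℂ) 3 := by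
    have h := (((hasDerivAt_id (3 : ℂ)).const_mul (π : ℂ)).div_const 2).ccos
    simpa [hsin0] using h
  have hG : DifferentiableAt ℂ
      (fun s : ℂ => 2 * (2 * (π : ℂ)) ^ (-s) * Gamma s * riemannZeta s) 3 := by
    refine ((DifferentiableAt.mul (differentiableAt_const _) ?_).mul ?_).mul ?_
    · exact differentiableAt_id.neg.const_cpow (Or.inl (by simp [hπ]))
    · refine differentiableAt_Gamma _ fun m h => ?_
      have := congrArg re h
      simp only [re_ofNat, neg_re, natCast_re] at this
      have : (0 : ℝ) ≤ m := m.cast_nonneg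
      linarith
    · exact differentiableAt_riemannZeta (by norm_num)
  have hR := (hcos.mul hG.hasDerivAt).congr_of_eventuallyEq h3
  have hL : HasDerivAt (fun s : ℂ => riemannZeta (1 - s)) (deriv riemannZeta (-2) * (-1)) 3 := by
    have hz : HasDerivAt riemannZeta (deriv riemannZeta (-2)) (1 - 3) := by
      rw [show (1 - 3 : ℂ) = -2 by norm_num]
      exact (differentiableAt_riemannZeta (by norm_num)).hasDerivAt
    exact hz.comp 3 ((hasDerivAt_id (3 : ℂ)).const_sub 1)
  have h := hL.unique hR
  rw [hcos0, zero_mul, add_zero] at h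
  have hGam : Gamma 3 = 2 := by
    simp [Nat.factorial]
  have hpow : (2 * π : ℂ) ^ (-3 : ℂ) = ((2 * π : ℂ) ^ 3)⁻¹ := by
    rw [cpow_neg, show (3 : ℂ) = ((3 : ℕ) : ℂ) by norm_num, cpow_natCast]
  rw [hGam, hpow] at h
  have h' : deriv riemannZeta (-2) = -(π / 2 * (2 * ((2 * π : ℂ) ^ 3)⁻¹ * 2 * riemannZeta 3)) := by
    rw [← h]; ring
  rw [h']
  field_simp
  ring

/-! ### The series of `zetaH` for `t ≥ 1` -/

theorem norm_one_div_natCast_add_cpow_le (k : ℕ) {t : ℝ} (ht : 1 ≤ t) {σ : ℝ} (hσ : 0 ≤ σ)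
    {s : ℂ} (hs : σ ≤ s.re) :
    ‖1 / ((k : ℂ) + (t : ℂ)) ^ s‖ ≤ 1 / ((k : ℝ) + 1) ^ σ := by
  have hk : (0 : ℝ) ≤ k := k.cast_nonneg
  have hkt : 0 < (k : ℝ) + t := by linarith
  have hcast : (k : ℂ) + (t : ℂ) = ((k + t : ℝ) : ℂ) := by push_cast; ring
  rw [norm_div, norm_one, hcast, norm_cpow_eq_rpow_re_of_pos hkt]
  refine one_div_le_one_div_of_le (by positivity) ?_
  calc ((k : ℝ) + 1) ^ σ ≤ ((k : ℝ) + t) ^ σ := by gcongr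
    _ ≤ ((k : ℝ) + t) ^ s.re := Real.rpow_le_rpow_of_exponent_le (by linarith) hs

theorem summable_one_div_natCast_add_one_rpow {σ : ℝ} (hσ : 1 < σ) :
    Summable fun k : ℕ => 1 / ((k : ℝ) + 1) ^ σ := by
  have h := (summable_nat_add_iff 1).2 (Real.summable_one_div_nat_rpow.2 hσ)
  simpa using h

/-- Weierstrass M-test: for `t ≥ 1` the terms are dominated by `(k+1)^(-σ)` with `1 < σ < Re s`.
Truncating with `max 1` makes the function continuous on all of `ℝ`, with no boundary point to
treat. -/
theorem continuousOn_zetaH_max_one :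
    ContinuousOn (fun p : ℂ × ℝ => zetaH p.1 (max 1 p.2)) ({s | 1 < s.re} ×ˢ univ) := by
  rintro ⟨s, t⟩ ⟨hs, -⟩
  have hs' : 1 < s.re := hs
  obtain ⟨σ, h1, h2⟩ := exists_between hs'
  have hopen : IsOpen ({z : ℂ | σ < z.re} ×ˢ (univ : Set ℝ)) :=
    (isOpen_lt continuous_const continuous_re).prod isOpen_univ
  have hcont : ContinuousOn
      (fun p : ℂ × ℝ => ∑' k : ℕ, 1 / ((k : ℂ) + ((max 1 p.2 : ℝ) : ℂ)) ^ p.1)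
      ({z : ℂ | σ < z.re} ×ˢ (univ : Set ℝ)) := by
    refine continuousOn_tsum (fun k => ?_) (summable_one_div_natCast_add_one_rpow h1)
      fun k p hp => norm_one_div_natCast_add_cpow_le k (le_max_left _ _) (by linarith)
        (le_of_lt hp.1)
    have hpos : ∀ p : ℂ × ℝ, 0 < (k : ℝ) + max 1 p.2 := fun p => by
      have : (0 : ℝ) ≤ k := k.cast_nonneg
      have := le_max_left 1 p.2
      linarith
    refine Continuous.continuousOn (continuous_const.div ?_ fun p => ?_)
    · refine Continuous.cpow (by fun_prop) continuous_fst fun p => ?_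
      rw [← ofReal_natCast, ← ofReal_add]
      exact ofReal_mem_slitPlane.2 (hpos p)
    · rw [← ofReal_natCast, ← ofReal_add]
      exact fun h => (ofReal_ne_zero.2 (hpos p).ne') ((cpow_eq_zero_iff _ _).1 h).1
  have hmem : (s, t) ∈ {z : ℂ | σ < z.re} ×ˢ (univ : Set ℝ) := ⟨h2, mem_univ t⟩
  refine ((hcont.congr fun p hp => ?_).continuousAt (hopen.mem_nhds hmem)).continuousWithinAt
  exact (hasSum_zetaH (zero_le_one.trans (le_max_left _ _)) (h1.trans hp.1)).tsum_eq.symm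

theorem one_sub_mul_integral_zetaH {s : ℂ} (hs : 2 < s.re) {x : ℝ} (hx : 1 ≤ x) :
    (1 - s) * ∫ t in (1 : ℝ)..x, zetaH s t = zetaH (s - 1) x - riemannZeta (s - 1) := by
  have hs1 : 1 < s.re := by linarith
  have hs2 : 1 < (s - 1).re := by rw [sub_re, one_re]; linarith
  have hsne : 1 - s ≠ 0 := fun h => by
    have := congrArg re h
    rw [sub_re, one_re, zero_re] at this
    linarith
  have hmem : ∀ t ∈ Set.uIoc 1 x, 1 ≤ t := fun t ht => by
    rw [uIoc_of_le hx] at ht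
    exact ht.1.le
  have hint : ∀ k : ℕ, ∫ t in (1 : ℝ)..x, 1 / ((k : ℂ) + (t : ℂ)) ^ s =
      (1 / ((k : ℂ) + (x : ℂ)) ^ (s - 1) - 1 / ((k : ℂ) + ((1 : ℝ) : ℂ)) ^ (s - 1)) / (1 - s) := by
    intro k
    have hk : (0 : ℝ) ≤ k := k.cast_nonneg
    have h0 : (0 : ℝ) ∉ uIcc ((k : ℝ) + 1) (k + x) := by
      rw [uIcc_of_le (by linarith)]
      exact fun h => by linarith [h.1]
    have h := integral_cpow (a := (k : ℝ) + 1) (b := k + x) (r := -s)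
      (Or.inr ⟨fun h => hsne (by rw [sub_eq_add_neg, h]; ring), h0⟩)
    rw [← intervalIntegral.integral_comp_add_left (fun u : ℝ => (u : ℂ) ^ (-s)) (k : ℝ)] at h
    rw [show -s + 1 = -(s - 1) by ring, show -(s - 1) = 1 - s by ring] at h
    simp only [one_div, ← cpow_neg]
    rw [neg_sub]
    push_cast at h ⊢
    exact h
  have hsum : HasSum (fun k : ℕ => ∫ t in (1 : ℝ)..x, 1 / ((k : ℂ) + (t : ℂ)) ^ s)
      (∫ t in (1 : ℝ)..x, zetaH s t) := by
    refine intervalIntegral.hasSum_integral_of_dominated_convergence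
      (fun k _ => 1 / ((k : ℝ) + 1) ^ s.re) (fun k => ?_) (fun k => ?_) ?_ ?_ ?_
    · refine Measurable.aestronglyMeasurable ?_
      exact measurable_const.div ((measurable_const.add measurable_ofReal).pow_const s)
    · exact Eventually.of_forall fun t ht =>
        norm_one_div_natCast_add_cpow_le k (hmem t ht) (by linarith) le_rfl
    · exact Eventually.of_forall fun t _ => summable_one_div_natCast_add_one_rpow hs1
    · exact intervalIntegrable_const
    · exact Eventually.of_forall fun t ht =>
        hasSum_zetaH (zero_le_one.trans (hmem t ht)) hs1
  simp only [hint] at hsum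
  have hsum' := ((hasSum_zetaH (zero_le_one.trans hx) hs2).sub
    (hasSum_zetaH zero_le_one hs2)).div_const (1 - s)
  rw [hsum.unique hsum', zetaH_one, mul_div_cancel₀ _ hsne]

/-! ### Continuity and the integral relation for all `s` -/

/-- The entire function `s ↦ ζ(s, t) - ζ(s)`, with `t` truncated below at `1`. -/
noncomputable def zetaHSub (s : ℂ) (t : ℝ) : ℂ :=
  zetaH s (max 1 t) - riemannZeta s

theorem differentiable_zetaHSub (t : ℝ) : Differentiable ℂ fun s => zetaHSub s t :=
  differentiable_zetaH_sub_riemannZeta (zero_lt_one.trans_le (le_max_left 1 t))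

/-- The right-hand side of the relation expressing `zetaHSub (s - 1) t` by an integral of
`zetaHSub s`. -/
noncomputable def zetaHSubIntegral (s : ℂ) (t : ℝ) : ℂ :=
  (1 - s) * (∫ u in (1 : ℝ)..(max 1 t), zetaHSub s u) - riemannZeta₁ s * ((max 1 t : ℝ) - 1)

/-- The subtracted `ζ(s)` is constant in `u` and enters through `(s - 1) ζ(s)`, which is the entire
function `riemannZeta₁`. -/
theorem zetaHSub_sub_one_of_two_lt_re {s : ℂ} (hs : 2 < s.re) (t : ℝ) :
    zetaHSub (s - 1) t = zetaHSubIntegral s t := by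
  have hs1 : 1 < s.re := by linarith
  have hsne : s - 1 ≠ 0 := fun h => by
    have := congrArg re h
    rw [sub_re, one_re, zero_re] at this
    linarith
  have hx : 1 ≤ max 1 t := le_max_left _ _
  have hcont : Continuous fun u : ℝ => zetaH s (max 1 u) :=
    continuousOn_zetaH_max_one.comp_continuous (f := fun u : ℝ => (s, u)) (by fun_prop)
      fun u => ⟨hs1, mem_univ _⟩
  have hcongr : ∫ u in (1 : ℝ)..(max 1 t), zetaH s (max 1 u) =
      ∫ u in (1 : ℝ)..(max 1 t), zetaH s u := by
    refine intervalIntegral.integral_congr fun u hu => ?_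
    rw [uIcc_of_le hx] at hu
    simp only [max_eq_right hu.1]
  have hz : riemannZeta₁ s = (s - 1) * riemannZeta s := by
    rw [riemannZeta_eq_inv_sub_mul (sub_ne_zero.1 hsne), mul_inv_cancel_left₀ hsne]
  simp only [zetaHSub, zetaHSubIntegral]
  rw [intervalIntegral.integral_sub (hcont.intervalIntegrable _ _) intervalIntegrable_const,
    hcongr, mul_sub, one_sub_mul_integral_zetaH hs hx, intervalIntegral.integral_const, hz,
    real_smul]
  push_cast
  ring

theorem hasDerivAt_zetaHSubIntegral {U : Set ℂ} (hU : IsOpen U)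
    (hf : ContinuousOn (fun p : ℂ × ℝ => zetaHSub p.1 p.2) (U ×ˢ univ)) {s : ℂ} (hs : s ∈ U)
    (t : ℝ) :
    HasDerivAt (fun z => zetaHSubIntegral z t)
      (-(∫ u in (1 : ℝ)..(max 1 t), zetaHSub s u) +
        (1 - s) * (∫ u in (1 : ℝ)..(max 1 t), deriv (fun z => zetaHSub z u) s) -
        deriv riemannZeta₁ s * ((max 1 t : ℝ) - 1)) s := by
  have h := (hasDerivAt_intervalIntegral_of_continuousOn_prod hU hf
    (fun t => (differentiable_zetaHSub t).differentiableOn) hs 1 (max 1 t)).2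
  have h1 := ((hasDerivAt_id s).const_sub 1).mul h
  have h2 := (differentiable_riemannZeta₁ s).hasDerivAt.mul_const (((max 1 t : ℝ) : ℂ) - 1)
  exact (h1.sub h2).congr_deriv (by simp only [neg_one_mul, id])

theorem zetaHSub_sub_one_of_continuousOn {σ : ℝ}
    (hf : ContinuousOn (fun p : ℂ × ℝ => zetaHSub p.1 p.2) ({s | σ < s.re} ×ˢ univ))
    {s : ℂ} (hs : σ < s.re) (t : ℝ) :
    zetaHSub (s - 1) t = zetaHSubIntegral s t := by
  have hU : IsOpen {z : ℂ | σ < z.re} := isOpen_lt continuous_const continuous_re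
  have hconn : IsPreconnected {z : ℂ | σ < z.re} := (convex_halfSpace_re_gt σ).isPreconnected
  have hL : AnalyticOnNhd ℂ (fun z => zetaHSub (z - 1) t) {z : ℂ | σ < z.re} :=
    DifferentiableOn.analyticOnNhd
      ((differentiable_zetaHSub t).comp (differentiable_id.sub_const 1)).differentiableOn hU
  have hR : AnalyticOnNhd ℂ (fun z => zetaHSubIntegral z t) {z : ℂ | σ < z.re} :=
    DifferentiableOn.analyticOnNhd (fun z hz =>
      (hasDerivAt_zetaHSubIntegral hU hf hz t).differentiableAt.differentiableWithinAt) hU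
  -- This base point lies in both half-planes `Re z > σ` and `Re z > 2`.
  have hz₀ : σ < (((max σ 2 + 1 : ℝ) : ℂ)).re := by
    rw [ofReal_re]; linarith [le_max_left σ 2]
  refine hL.eqOn_of_preconnected_of_eventuallyEq hR hconn hz₀ ?_ hs
  have h2 : {z : ℂ | 2 < z.re} ∈ 𝓝 ((max σ 2 + 1 : ℝ) : ℂ) :=
    (isOpen_lt continuous_const continuous_re).mem_nhds (by
      change 2 < (((max σ 2 + 1 : ℝ) : ℂ)).re
      rw [ofReal_re]; linarith [le_max_right σ 2])
  filter_upwards [h2] with z hz using zetaHSub_sub_one_of_two_lt_re hz t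

/-- Bootstrap: continuity on a half-plane makes the integral relation valid there, and the relation
then gives continuity one unit further left. -/
theorem continuousOn_zetaHSub (m : ℕ) :
    ContinuousOn (fun p : ℂ × ℝ => zetaHSub p.1 p.2) ({s | 1 - (m : ℝ) < s.re} ×ˢ univ) := by
  induction m with
  | zero =>
    simp only [Nat.cast_zero, sub_zero]
    refine continuousOn_zetaH_max_one.sub fun p hp => ?_
    have hne : p.1 ≠ 1 := fun h => by
      have := hp.1
      rw [h] at this
      simp at this
    exact ((differentiableAt_riemannZeta hne).continuousAt.comp
      continuousAt_fst).continuousWithinAt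
  | succ m ih =>
    have hint : Continuous fun p : {s : ℂ | 1 - (m : ℝ) < s.re} × ℝ =>
        ∫ u in (1 : ℝ)..(max 1 p.2), zetaHSub p.1 u := by
      have hc : Continuous fun q : ({s : ℂ | 1 - (m : ℝ) < s.re} × ℝ) × ℝ =>
          zetaHSub q.1.1 q.2 :=
        ih.comp_continuous (f := fun q : ({s : ℂ | 1 - (m : ℝ) < s.re} × ℝ) × ℝ =>
          ((q.1.1 : ℂ), q.2)) (by fun_prop) fun q => ⟨q.1.1.2, mem_univ _⟩
      exact intervalIntegral.continuous_parametric_intervalIntegral_of_continuous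
        (f := fun (p : {s : ℂ | 1 - (m : ℝ) < s.re} × ℝ) u => zetaHSub p.1 u) hc
        (by fun_prop)
    have hR : Continuous fun p : {s : ℂ | 1 - (m : ℝ) < s.re} × ℝ =>
        zetaHSubIntegral p.1 p.2 := by
      have h1 := differentiable_riemannZeta₁.continuous
      unfold zetaHSubIntegral
      fun_prop
    rw [continuousOn_iff_continuous_domRestrict]
    have hmap : ∀ p : ({s : ℂ | 1 - ((m + 1 : ℕ) : ℝ) < s.re} ×ˢ (univ : Set ℝ) : Set (ℂ × ℝ)),
        1 - (m : ℝ) < (p.1.1 + 1).re := fun p => by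
      have : 1 - ((m + 1 : ℕ) : ℝ) < p.1.1.re := p.2.1
      rw [add_re, one_re]
      push_cast at this
      linarith
    refine (hR.comp (Continuous.prodMk (Continuous.subtype_mk
      (f := fun p => (p.1.1 + 1 : ℂ)) (by fun_prop) hmap)
      (continuous_snd.comp continuous_subtype_val))).congr fun p => ?_
    have h := zetaHSub_sub_one_of_continuousOn ih (hmap p) p.1.2
    rw [add_sub_cancel_right] at h
    exact h.symm

theorem zetaHSub_sub_one (s : ℂ) (t : ℝ) : zetaHSub (s - 1) t = zetaHSubIntegral s t := by
  obtain ⟨m, hm⟩ := exists_nat_gt (1 - s.re)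
  exact zetaHSub_sub_one_of_continuousOn (continuousOn_zetaHSub m) (by linarith) t

theorem zetaHDeriv_eq_deriv_zetaHSub_add {s : ℂ} (hs : s ≠ 1) {t : ℝ} (ht : 1 ≤ t) :
    zetaHDeriv s t = deriv (fun z => zetaHSub z t) s + deriv riemannZeta s := by
  have h := (differentiable_zetaHSub t s).hasDerivAt.add (differentiableAt_riemannZeta hs).hasDerivAt
  rw [← h.deriv, zetaHDeriv]
  congr 1
  ext z
  simp [zetaHSub, max_eq_right ht]

/-- Differentiating the relation in `s` leaves a term `-∫ ζ(s,t) dt`; multiplying by `1 - s` and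
applying the relation again eliminates it, whence the square. -/
theorem intervalIntegrable_and_integral_zetaHDeriv_of_one_le {s : ℂ} (hs1 : s ≠ 1) (hs2 : s ≠ 2)
    {x : ℝ} (hx : 1 ≤ x) :
    IntervalIntegrable (fun t => zetaHDeriv s t) volume 1 x ∧
      (1 - s) ^ 2 * ∫ t in (1 : ℝ)..x, zetaHDeriv s t =
        zetaH (s - 1) x - riemannZeta (s - 1) +
          (1 - s) * (zetaHDeriv (s - 1) x - deriv riemannZeta (s - 1)) := by
  obtain ⟨m, hm⟩ := exists_nat_gt (1 - s.re)
  have hU : IsOpen {z : ℂ | 1 - (m : ℝ) < z.re} := isOpen_lt continuous_const continuous_re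
  have hs : s ∈ {z : ℂ | 1 - (m : ℝ) < z.re} := by
    change 1 - (m : ℝ) < s.re
    linarith
  have hsne : s - 1 ≠ 0 := sub_ne_zero.2 hs1
  have hs2' : s - 1 ≠ 1 := fun h => hs2 (by linear_combination h)
  have hint := (hasDerivAt_intervalIntegral_of_continuousOn_prod hU (continuousOn_zetaHSub m)
    (fun t => (differentiable_zetaHSub t).differentiableOn) hs 1 x).1
  have heq : ∀ t ∈ uIcc 1 x,
      deriv (fun z => zetaHSub z t) s + deriv riemannZeta s = zetaHDeriv s t := fun t ht => by
    rw [uIcc_of_le hx] at ht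
    exact (zetaHDeriv_eq_deriv_zetaHSub_add hs1 ht.1).symm
  refine ⟨(hint.add intervalIntegrable_const).congr fun t ht => heq t (uIoc_subset_uIcc ht), ?_⟩
  rw [← intervalIntegral.integral_congr heq, intervalIntegral.integral_add hint
    intervalIntegrable_const, intervalIntegral.integral_const, real_smul]
  have hd : HasDerivAt (fun z => zetaHSub (z - 1) x) (deriv (fun z => zetaHSub z x) (s - 1)) s :=
    (differentiable_zetaHSub x (s - 1)).hasDerivAt.comp_sub_const s 1
  have hd' := hasDerivAt_zetaHSubIntegral hU (continuousOn_zetaHSub m) hs x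
  simp only [zetaHSub_sub_one] at hd
  have h1 := hd.unique hd'
  have h2 := zetaHSub_sub_one s x
  have hz : ∀ z : ℂ, z ≠ 1 → riemannZeta₁ z = (z - 1) * riemannZeta z := fun z hz => by
    rw [riemannZeta_eq_inv_sub_mul hz, mul_inv_cancel_left₀ (sub_ne_zero.2 hz)]
  have hz' : deriv riemannZeta₁ s = riemannZeta s + (s - 1) * deriv riemannZeta s := by
    have h := ((hasDerivAt_id s).sub_const 1).mul (differentiableAt_riemannZeta hs1).hasDerivAt
    have h' := h.congr_of_eventuallyEq (f₁ := riemannZeta₁) (by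
      filter_upwards [isOpen_ne.mem_nhds hs1] with z hz₁ using hz z hz₁)
    rw [h'.deriv]
    simp
  rw [zetaHSubIntegral, hz s hs1, max_eq_right hx, zetaHSub, max_eq_right hx] at h2
  rw [hz', max_eq_right hx] at h1
  rw [zetaHDeriv_eq_deriv_zetaHSub_add hs2' hx, h1]
  push_cast
  linear_combination -h2

/-! ### Unit shift and the logarithmic singularity at `t = 0` -/

theorem zetaHDeriv_eq_add {t : ℝ} (ht : 0 < t) (n : ℕ) :
    zetaHDeriv (-n) t = -((Real.log t * t ^ n : ℝ) : ℂ) + zetaHDeriv (-n) (t + 1) := by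
  have ht0 : (t : ℂ) ≠ 0 := ofReal_ne_zero.2 ht.ne'
  have hn1 : (-n : ℂ) ≠ 1 := fun h => by
    have := congrArg re h
    simp only [neg_re, natCast_re, one_re] at this
    have : (0 : ℝ) ≤ n := n.cast_nonneg
    linarith
  have h1 : HasDerivAt (fun z : ℂ => (t : ℂ) ^ (-z)) ((t : ℂ) ^ (n : ℂ) * log t * (-1)) (-n) := by
    have h := (hasDerivAt_neg (-n : ℂ)).const_cpow (c := (t : ℂ)) (Or.inl ht0)
    rwa [neg_neg] at h
  have h2 := (differentiableAt_zetaH (t := t + 1) (by linarith) hn1).hasDerivAt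
  have h3 := h1.add h2
  have h4 : (fun z => zetaH z t) = fun z => (t : ℂ) ^ (-z) + zetaH z (t + 1) := by
    ext z
    rw [zetaH_eq_cpow_add ht, cpow_neg, one_div]
  rw [zetaHDeriv, h4]
  refine h3.deriv.trans ?_
  rw [zetaHDeriv, cpow_natCast]
  push_cast [ofReal_log ht.le]
  ring

theorem intervalIntegrable_log_mul_pow (n : ℕ) (a b : ℝ) :
    IntervalIntegrable (fun t => Real.log t * t ^ n) volume a b :=
  intervalIntegral.intervalIntegrable_log'.mul_continuousOn (by fun_prop)

theorem integral_log_mul_pow {n : ℕ} (hn : n ≠ 0) {x : ℝ} (hx : 0 ≤ x) :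
    ∫ t in (0 : ℝ)..x, Real.log t * t ^ (n - 1) =
      Real.log x * x ^ n / n - x ^ n / (n : ℝ) ^ 2 := by
  obtain ⟨m, rfl⟩ := Nat.exists_eq_succ_of_ne_zero hn
  have hm : ((m + 1 : ℕ) : ℝ) ≠ 0 := by positivity
  -- The primitive is grouped around `t * log t`, which is continuous at `0`.
  have h := intervalIntegral.integral_eq_sub_of_hasDerivAt_of_le hx
    (f := fun t => (t * Real.log t) * t ^ m / (m + 1 : ℕ) - t ^ (m + 1) / ((m + 1 : ℕ) : ℝ) ^ 2)
    (f' := fun t => Real.log t * t ^ m) ?_ ?_ (intervalIntegrable_log_mul_pow m 0 x)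
  · rw [Nat.succ_eq_add_one, Nat.add_sub_cancel, h]
    simp
    ring
  · have := Real.continuous_mul_log
    exact Continuous.continuousOn (by fun_prop)
  · intro t ht
    have ht0 : t ≠ 0 := ht.1.ne'
    have hl : HasDerivAt (fun t => Real.log t * t ^ (m + 1))
        (t⁻¹ * t ^ (m + 1) + Real.log t * ((m + 1 : ℕ) * t ^ m)) t :=
      (Real.hasDerivAt_log ht0).mul (hasDerivAt_pow (m + 1) t)
    have h := (hl.div_const ((m + 1 : ℕ) : ℝ)).sub
      ((hasDerivAt_pow (m + 1) t).div_const (((m + 1 : ℕ) : ℝ) ^ 2))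
    have hfun : (fun t => (t * Real.log t) * t ^ m / (m + 1 : ℕ) -
        t ^ (m + 1) / ((m + 1 : ℕ) : ℝ) ^ 2) =
        (fun t => Real.log t * t ^ (m + 1) / (m + 1 : ℕ)) -
          fun t => t ^ (m + 1) / ((m + 1 : ℕ) : ℝ) ^ 2 := by
      ext t
      simp only [Pi.sub_apply]
      ring
    rw [hfun]
    refine h.congr_deriv ?_
    rw [Nat.add_sub_cancel]
    field_simp
    ring

theorem zetaHDeriv_zero_right (s : ℂ) : zetaHDeriv s 0 = deriv riemannZeta s := by
  simp only [zetaHDeriv, zetaH_zero]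

theorem intervalIntegrable_and_integral_zetaHDeriv {n : ℕ} (hn : n ≠ 0) {ν : ℝ} (hν : 0 ≤ ν) :
    IntervalIntegrable (fun t : ℝ => zetaHDeriv (1 - (n : ℂ)) t) volume 0 ν ∧
      (n : ℂ) * ∫ t in (0 : ℝ)..ν, zetaHDeriv (1 - (n : ℂ)) t =
        ((bernoulli (n + 1) : ℂ) - (bernoulliFun (n + 1) ν : ℂ)) / ((n : ℂ) * ((n : ℂ) + 1))
          + zetaHDeriv (-(n : ℂ)) ν - zetaHDeriv (-(n : ℂ)) 0 := by
  -- The unit shift is applied at `ν` itself, which requires `ν > 0`.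
  rcases hν.eq_or_lt with rfl | hpos
  · simp [bernoulliFun_eval_zero]
  have hn0 : (n : ℂ) ≠ 0 := Nat.cast_ne_zero.2 hn
  have hn1 : (n : ℂ) + 1 ≠ 0 := by exact_mod_cast n.succ_ne_zero
  have hcast : (1 - n : ℂ) = -((n - 1 : ℕ) : ℂ) := by
    rw [Nat.cast_sub (Nat.one_le_iff_ne_zero.2 hn)]
    push_cast
    ring
  have hs1 : (1 - n : ℂ) ≠ 1 := fun h => hn0 (by linear_combination -h)
  have hs2 : (1 - n : ℂ) ≠ 2 := fun h => hn1 (by linear_combination -h)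
  obtain ⟨hi, hI⟩ := intervalIntegrable_and_integral_zetaHDeriv_of_one_le hs1 hs2
    (x := ν + 1) (by linarith)
  have hi' : IntervalIntegrable (fun t => zetaHDeriv (1 - (n : ℂ)) (t + 1)) volume 0 ν := by
    simpa using hi.comp_add_right 1
  have hlog : IntervalIntegrable (fun t : ℝ => -((Real.log t * t ^ (n - 1) : ℝ) : ℂ)) volume 0 ν := by
    have h := intervalIntegrable_log_mul_pow (n - 1) 0 ν
    exact IntervalIntegrable.neg ⟨h.1.ofReal, h.2.ofReal⟩
  have heq : ∀ t ∈ uIoc 0 ν, -((Real.log t * t ^ (n - 1) : ℝ) : ℂ) +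
      zetaHDeriv (1 - (n : ℂ)) (t + 1) = zetaHDeriv (1 - (n : ℂ)) t := fun t ht => by
    rw [uIoc_of_le hν] at ht
    rw [hcast, ← zetaHDeriv_eq_add ht.1]
  refine ⟨(hlog.add hi').congr heq, ?_⟩
  rw [← intervalIntegral.integral_congr_ae (Eventually.of_forall heq),
    intervalIntegral.integral_add hlog hi', intervalIntegral.integral_neg,
    intervalIntegral.integral_ofReal, integral_log_mul_pow hn hν,
    intervalIntegral.integral_comp_add_right (fun t => zetaHDeriv (1 - (n : ℂ)) t), zero_add,
    zetaHDeriv_eq_add hpos, zetaHDeriv_zero_right]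
  have hval := zetaH_neg_nat hn (t := ν + 1) (by linarith)
  have hval0 := zetaH_neg_nat hn le_rfl
  rw [zetaH_zero, bernoulliFun_eval_zero] at hval0
  -- The jump `(n+1) ν^n` of the Bernoulli polynomial from `ν` to `ν + 1` cancels the `ν^n / n^2`
  -- term of the logarithmic integral.
  rw [show (1 - n - 1 : ℂ) = -n by ring, sub_sub_cancel, hval, hval0, bernoulliFun_add_one,
    Nat.add_sub_cancel] at hI
  refine mul_left_cancel₀ hn0 ?_
  push_cast at hI ⊢
  rw [mul_add, mul_add, ← mul_assoc (n : ℂ) (n : ℂ) (∫ _ in _.._, _), ← sq, hI]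
  field_simp
  ring

end HurwitzIntegral

theorem mainTheorem12 :
    (∀ (n : ℕ) (ν : ℝ), 1 ≤ n → 0 ≤ ν →
      IntervalIntegrable (fun t : ℝ => zetaHDeriv (1 - (n : ℂ)) t) MeasureTheory.volume 0 ν ∧
      (n : ℂ) * ∫ t in (0 : ℝ)..ν, zetaHDeriv (1 - (n : ℂ)) t =
        ((bernoulli (n + 1) : ℂ) - (bernoulliFun (n + 1) ν : ℂ)) / ((n : ℂ) * ((n : ℂ) + 1))
          + zetaHDeriv (-(n : ℂ)) ν - zetaHDeriv (-(n : ℂ)) 0) ∧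
    (∀ ν : ℝ, 0 ≤ ν →
      IntervalIntegrable (fun t : ℝ => zetaHDeriv (-1) t) MeasureTheory.volume 0 ν ∧
      ∫ t in (0 : ℝ)..ν, zetaHDeriv (-1) t =
        -(1 / 12) * (bernoulliFun 3 ν : ℂ) + (1 / 2) * zetaHDeriv (-2) ν
          + riemannZeta 3 / (8 * (π : ℂ) ^ 2)) := by
  refine ⟨fun n ν hn hν => intervalIntegrable_and_integral_zetaHDeriv
    (Nat.one_le_iff_ne_zero.1 hn) hν, fun ν hν => ?_⟩
  obtain ⟨hi, hI⟩ := intervalIntegrable_and_integral_zetaHDeriv two_ne_zero hν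
  have hb : bernoulli 3 = 0 := bernoulli_eq_zero_of_odd (by decide) (by norm_num)
  rw [zetaHDeriv_zero_right] at hI
  norm_num [hb] at hi hI
  refine ⟨hi, ?_⟩
  rw [deriv_riemannZeta_neg_two] at hI
  linear_combination hI / 2
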